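/- Let $\mathcal S$ and $\mathcal A$ be finite sets (of states and of actions, $\mathcal A\neq\emptyset$), $\tau:\mathcal S\times\mathcal A\to\Delta(\mathcal S)$ a transition function, $\mu_0\in\Delta(\mathcal S)$ an initial state distribution and $\gamma\in(0,1)$ a discount rate, such that every state is reachable under $\tau$ and $\mu_0$. Let $\mathcal R$ be the vector space of all reward functions $R:\mathcal S\times\mathcal A\times\mathcal S\to\mathbb R$. A policy is a function $\pi:\mathcal S\to\Delta(\mathcal A)$, and $J_R(\pi)=\mathbb E\left[\sum_{t\ge 0}\gamma^t R(s_t,a_t,s_{t+1})\right]$, the expectation being over trajectories with $s_0\sim\mu_0$, $a_t\sim\pi(s_t)$, $s_{t+1}\sim\tau(s_t,a_t)$; write $J_i=J_{R_i}$. *Definitions.* $R_2$ is produced from $R_1$ by potential shaping if $R_2(s,a,s')=R_1(s,a,s')+\gamma\Phi(s')-\Phi(s)$ for some $\Phi:\mathcal S\to\mathbb R$; $R_1$ and $R_2$ differ by $S'$-redistribution if $\mathbb E_{S'\sim\tau(s,a)}[R_1(s,a,S')]=\mathbb E_{S'\sim\tau(s,a)}[R_2(s,a,S')]$ for all $s,a$.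 A linear map $c:\mathcal R\to\mathcal R$ is a canonicalisation function if, for every $R$, $c(R)$ and $R$ differ by a composition of potential shaping and $S'$-redistribution, and $c(R_1)=c(R_2)$ if and only if $R_1$ and $R_2$ differ by such a composition. A function $d:\mathcal R\times\mathcal R\to\mathbb R$ is a STARC metric if there are a canonicalisation function $c$, a function $n$ that is a norm on $\mathrm{Im}(c)$, and a metric $m$ on $\mathrm{Im}(s)$ such that $d(R_1,R_2)=m(s(R_1),s(R_2))$ for all $R_1,R_2$, where $s(R)=c(R)/n(c(R))$ if $n(c(R))\ne0$ and $s(R)=c(R)$ otherwise, and where $m$ is admissible: for some norm $p$ on $\mathcal R$ and some constants $\ell,u>0$, $\ell\,p(x-y)\le m(x,y)\le u\,p(x-y)$ for all $x,y\in\mathrm{Im}(s)$. *Theorem.* Every STARC metric $d$ is complete; that is, $d$ is a pseudometric on $\mathcal R$, and: 1. there is a constant $L>0$ such that for all $R_1,R_2\in\mathcal R$ there exist policies $\pi_1,\pi_2$ with $J_2(\pi_2)\ge J_2(\pi_1)$ and $$J_1(\pi_1)-J_1(\pi_2)\ \ge\ L\cdot\Big(\max_\pi J_1(\pi)-\min_\pi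 J_1(\pi)\Big)\cdot d(R_1,R_2);$$ 2. if $R_1$ and $R_2$ induce the same ordering of policies, i.e. $J_1(\pi)\le J_1(\pi')\iff J_2(\pi)\le J_2(\pi')$ for all policies $\pi,\pi'$, then $d(R_1,R_2)=0$. -/

import Mathlib

noncomputable section

open MeasureTheory ProbabilityTheory

namespace STARC

/-- Reward functions `R : S × A × S → ℝ`, in curried form. -/
abbrev Reward (S A : Type*) := S → A → S → ℝ

/-- (Stationary, stochastic) policies `π : S → Δ(A)`. -/
abbrev Policy (S A : Type*) := S → PMF A

/-- An environment with states `S` and actions `A`: a Markov decision process without its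
reward function. -/
structure Env (S A : Type*) where
  /-- the transition function -/
  τ : S → A → PMF S
  /-- the initial state distribution -/
  μ₀ : PMF S
  /-- the discount rate -/
  γ : ℝ
  γ_pos : 0 < γ
  γ_lt_one : γ < 1

namespace Env

variable {S A : Type*} (E : Env S A)

/-- The state `s` is reachable under the transition function and the initial state distribution:
a finite path of transitions of positive probability leads to `s` from a state of positive
initial probability. -/
def IsReachable (s : S) : Prop :=
  ∃ s₀ ∈ E.μ₀.support,
    Relation.ReflTransGen (fun x y => ∃ a, y ∈ (E.τ x a).support) s₀ s

/-- The joint law of a state drawn from `p` and of the action that `π` takes in it. -/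
def stepLaw (π : Policy S A) (p : PMF S) : PMF (S × A) :=
  p.bind fun s => (π s).map fun a => (s, a)

/-- The return `G(ξ) = ∑ γ ^ t R(s_t, a_t, s_{t+1})` of a trajectory `ξ`. -/
def ret (R : Reward S A) (ξ : ℕ → S × A) : ℝ :=
  ∑' t : ℕ, E.γ ^ t * R (ξ t).1 (ξ t).2 (ξ (t + 1)).1

section Trajectories

variable [Fintype S] [MeasurableSpace S] [MeasurableSingletonClass S]
  [Fintype A] [MeasurableSpace A] [MeasurableSingletonClass A]

/-- The conditional law of `(s_{n+1}, a_{n+1})` given `(s_0, a_0), …, (s_n, a_n)`. -/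
def stepKernel (π : Policy S A) (n : ℕ) : Kernel (Finset.Iic n → S × A) (S × A) :=
  Kernel.ofFunOfCountable fun h =>
    (stepLaw π (E.τ (h ⟨n, Finset.mem_Iic.2 le_rfl⟩).1
      (h ⟨n, Finset.mem_Iic.2 le_rfl⟩).2)).toMeasure

instance (π : Policy S A) (n : ℕ) : IsMarkovKernel (E.stepKernel π n) :=
  ⟨fun _ => PMF.toMeasure.isProbabilityMeasure _⟩

/-- The law of the trajectory `⟨s_0, a_0, s_1, a_1, …⟩` of the policy `π`, a trajectory being
written as the sequence of the pairs `(s_t, a_t)`. -/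
def trajLaw (π : Policy S A) : Measure (ℕ → S × A) :=
  Kernel.trajMeasure (X := fun _ => S × A) (stepLaw π E.μ₀).toMeasure (E.stepKernel π)

instance (π : Policy S A) : IsProbabilityMeasure (E.trajLaw π) := by
  unfold trajLaw
  infer_instance

/-- The policy evaluation function `J(π)`, the expected return of a trajectory of `π`. -/
def J (R : Reward S A) (π : Policy S A) : ℝ := ∫ ξ, E.ret R ξ ∂(E.trajLaw π)

/-- The range `max_π J(π) - min_π J(π)` of the policy evaluation function. -/
def rangeJ (R : Reward S A) : ℝ := (⨆ π, E.J R π) - ⨅ π, E.J R π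

/-- The two rewards induce the same ordering of policies. -/
def SamePolicyOrder (R₁ R₂ : Reward S A) : Prop :=
  ∀ π π' : Policy S A, E.J R₁ π ≤ E.J R₁ π' ↔ E.J R₂ π ≤ E.J R₂ π'

end Trajectories

/-- `R₂` is produced by potential shaping of `R₁`. -/
def PotentialShaping (R₁ R₂ : Reward S A) : Prop :=
  ∃ Φ : S → ℝ, ∀ s a s', R₂ s a s' = R₁ s a s' + E.γ * Φ s' - Φ s

variable [Fintype S]

/-- `R₁` and `R₂` differ by `S'`-redistribution. -/
def Redistribution (R₁ R₂ : Reward S A) : Prop :=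
  ∀ s a, ∑ s', (E.τ s a s').toReal * R₁ s a s' = ∑ s', (E.τ s a s').toReal * R₂ s a s'

/-- `R₁` and `R₂` differ by potential shaping and `S'`-redistribution: one gets from `R₁` to `R₂`
by composing the two kinds of transformation. See `differ_iff_reflTransGen`: allowing any finite
number of compositions, in any order, gives the same relation. -/
def Differ (R₁ R₂ : Reward S A) : Prop :=
  ∃ R, E.PotentialShaping R₁ R ∧ E.Redistribution R R₂

theorem differ_iff_reflTransGen (R₁ R₂ : Reward S A) :
    E.Differ R₁ R₂ ↔ Relation.ReflTransGen
      (fun R R' => E.PotentialShaping R R' ∨ E.Redistribution R R') R₁ R₂ := by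
  constructor
  · rintro ⟨R, h, h'⟩
    exact .tail (b := R) (.single (Or.inl h)) (Or.inr h')
  · intro h
    induction h with
    | refl => exact ⟨R₁, ⟨0, by simp⟩, fun _ _ => rfl⟩
    | tail _ hstep ih =>
      rename_i R' R''
      obtain ⟨R, ⟨Φ, hΦ⟩, hR⟩ := ih
      rcases hstep with ⟨Ψ, hΨ⟩ | hred
      · refine ⟨fun s a s' => R s a s' + E.γ * Ψ s' - Ψ s, ⟨Φ + Ψ, fun s a s' => ?_⟩,
          fun s a => ?_⟩
        · simp only [hΦ, Pi.add_apply]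
          ring
        · simp only [hΨ, mul_add, mul_sub, Finset.sum_add_distrib, Finset.sum_sub_distrib, hR s a]
      · exact ⟨R, ⟨Φ, hΦ⟩, fun s a => (hR s a).trans (hred s a)⟩

/-- The linear map `c` is a canonicalisation function. -/
structure IsCanonicalisation (c : Reward S A →ₗ[ℝ] Reward S A) : Prop where
  differ_self : ∀ R, E.Differ R (c R)
  eq_iff : ∀ R₁ R₂, c R₁ = c R₂ ↔ E.Differ R₁ R₂

end Env

/-- `n` is a norm on the linear subspace `W`; its values outside `W` are irrelevant. -/
structure IsNormOn {V : Type*} [AddCommGroup V] [Module ℝ V] (W : Submodule ℝ V) (n : V → ℝ) :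
    Prop where
  nonneg : ∀ x ∈ W, 0 ≤ n x
  eq_zero_iff : ∀ x ∈ W, n x = 0 ↔ x = 0
  smul : ∀ (r : ℝ), ∀ x ∈ W, n (r • x) = |r| * n x
  add_le : ∀ x ∈ W, ∀ y ∈ W, n (x + y) ≤ n x + n y

/-- `d` is a pseudometric on the set `X`. -/
structure IsPseudometricOn {V : Type*} (X : Set V) (d : V → V → ℝ) : Prop where
  self : ∀ x ∈ X, d x x = 0
  nonneg : ∀ x ∈ X, ∀ y ∈ X, 0 ≤ d x y
  symm : ∀ x ∈ X, ∀ y ∈ X, d x y = d y x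
  triangle : ∀ x ∈ X, ∀ y ∈ X, ∀ z ∈ X, d x z ≤ d x y + d y z

/-- `m` is a metric on the set `X`; its values outside `X` are irrelevant. -/
structure IsMetricOn {V : Type*} (X : Set V) (m : V → V → ℝ) : Prop
    extends IsPseudometricOn X m where
  eq_of_eq_zero : ∀ x ∈ X, ∀ y ∈ X, m x y = 0 → x = y

/-- `m` is an admissible metric on the set `X` of vectors: a metric that is bilipschitz equivalent
to (the metric of) a norm. -/
def IsAdmissibleOn {V : Type*} [AddCommGroup V] [Module ℝ V] (X : Set V) (m : V → V → ℝ) : Prop :=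
  IsMetricOn X m ∧ ∃ p : V → ℝ, IsNormOn ⊤ p ∧ ∃ l u : ℝ, 0 < l ∧ 0 < u ∧
    ∀ x ∈ X, ∀ y ∈ X, l * p (x - y) ≤ m x y ∧ m x y ≤ u * p (x - y)

open Classical in
/-- The standardised reward `s(R)`, which is `c(R) / n(c(R))` if `n(c(R)) ≠ 0` and `c(R)`
otherwise. -/
def standardise {V : Type*} [AddCommGroup V] [Module ℝ V] (c : V →ₗ[ℝ] V) (n : V → ℝ) (R : V) :
    V :=
  if n (c R) ≠ 0 then (n (c R))⁻¹ • c R else c R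

namespace Env

section WellDefined

/-! Well-definedness of the return. -/

variable {S A : Type*} (E : Env S A)

theorem norm_ret_term_le {R : Reward S A} {B : ℝ} (hB : ∀ s a s', ‖R s a s'‖ ≤ B)
    (ξ : ℕ → S × A) (t : ℕ) :
    ‖E.γ ^ t * R (ξ t).1 (ξ t).2 (ξ (t + 1)).1‖ ≤ E.γ ^ t * B := by
  rw [norm_mul, norm_pow, Real.norm_of_nonneg E.γ_pos.le]
  exact mul_le_mul_of_nonneg_left (hB _ _ _) (pow_nonneg E.γ_pos.le t)

theorem summable_geometric_mul (B : ℝ) : Summable fun t : ℕ => E.γ ^ t * B :=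
  (summable_geometric_of_lt_one E.γ_pos.le E.γ_lt_one).mul_right B

theorem norm_ret_le {R : Reward S A} {B : ℝ} (hB : ∀ s a s', ‖R s a s'‖ ≤ B) (ξ : ℕ → S × A) :
    ‖E.ret R ξ‖ ≤ ∑' t : ℕ, E.γ ^ t * B :=
  tsum_of_norm_bounded (E.summable_geometric_mul B).hasSum (E.norm_ret_term_le hB ξ)

variable [Fintype S] [Fintype A]

theorem exists_bound (R : Reward S A) : ∃ B : ℝ, ∀ s a s', ‖R s a s'‖ ≤ B := by
  obtain ⟨B, hB⟩ := (Set.finite_range fun x : S × A × S => ‖R x.1 x.2.1 x.2.2‖).bddAbove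
  exact ⟨B, fun s a s' => hB ⟨(s, a, s'), rfl⟩⟩

theorem summable_ret (R : Reward S A) (ξ : ℕ → S × A) :
    Summable fun t : ℕ => E.γ ^ t * R (ξ t).1 (ξ t).2 (ξ (t + 1)).1 := by
  obtain ⟨B, hB⟩ := exists_bound R
  exact .of_norm_bounded (E.summable_geometric_mul B) (E.norm_ret_term_le hB ξ)

end WellDefined

variable {S A : Type*} [Fintype S] (E : Env S A)

/-- `d` is a STARC (STAndardised Reward Comparison) metric. -/
def IsSTARC (d : Reward S A → Reward S A → ℝ) : Prop :=
  ∃ (c : Reward S A →ₗ[ℝ] Reward S A) (n : Reward S A → ℝ) (m : Reward S A → Reward S A → ℝ),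
    E.IsCanonicalisation c ∧ IsNormOn (LinearMap.range c) n ∧
    IsAdmissibleOn (Set.range (standardise c n)) m ∧
    ∀ R₁ R₂, d R₁ R₂ = m (standardise c n R₁) (standardise c n R₂)

variable [MeasurableSpace S] [MeasurableSingletonClass S]
  [Fintype A] [MeasurableSpace A] [MeasurableSingletonClass A]

/-- `d` is a complete pseudometric on the set of all reward functions (it induces a lower bound on
worst-case regret). -/
structure IsComplete (d : Reward S A → Reward S A → ℝ) : Prop where
  pseudometric : IsPseudometricOn Set.univ d
  regret : ∃ L : ℝ, 0 < L ∧ ∀ R₁ R₂ : Reward S A, ∃ π₁ π₂ : Policy S A,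
    E.J R₂ π₁ ≤ E.J R₂ π₂ ∧ L * E.rangeJ R₁ * d R₁ R₂ ≤ E.J R₁ π₁ - E.J R₁ π₂
  same_order : ∀ R₁ R₂ : Reward S A, E.SamePolicyOrder R₁ R₂ → d R₁ R₂ = 0

/-! Measurability and integrability of the return, boundedness of `J`. -/

theorem measurable_ret (R : Reward S A) : Measurable (E.ret R) := by
  refine Measurable.tsum fun t => ?_
  have h : Measurable fun x : (S × A) × (S × A) => E.γ ^ t * R x.1.1 x.1.2 x.2.1 :=
    measurable_of_countable _
  exact h.comp (g := fun x : (S × A) × (S × A) => E.γ ^ t * R x.1.1 x.1.2 x.2.1)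
    (f := fun ξ : ℕ → S × A => (ξ t, ξ (t + 1)))
    ((measurable_pi_apply t).prodMk (measurable_pi_apply (t + 1)))

theorem integrable_ret (R : Reward S A) (π : Policy S A) :
    Integrable (E.ret R) (E.trajLaw π) := by
  obtain ⟨B, hB⟩ := exists_bound R
  exact .of_bound (E.measurable_ret R).aestronglyMeasurable _
    (Filter.Eventually.of_forall (E.norm_ret_le hB))

theorem exists_abs_J_le (R : Reward S A) : ∃ K : ℝ, ∀ π : Policy S A, |E.J R π| ≤ K := by
  obtain ⟨B, hB⟩ := exists_bound R
  refine ⟨∑' t : ℕ, E.γ ^ t * B, fun π => ?_⟩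
  simpa [J] using norm_integral_le_of_norm_le_const (μ := E.trajLaw π)
    (Filter.Eventually.of_forall (E.norm_ret_le hB))

theorem bddAbove_range_J (R : Reward S A) : BddAbove (Set.range (E.J R)) := by
  obtain ⟨K, hK⟩ := E.exists_abs_J_le R
  exact ⟨K, by rintro _ ⟨π, rfl⟩; exact (abs_le.1 (hK π)).2⟩

theorem bddBelow_range_J (R : Reward S A) : BddBelow (Set.range (E.J R)) := by
  obtain ⟨K, hK⟩ := E.exists_abs_J_le R
  exact ⟨-K, by rintro _ ⟨π, rfl⟩; exact (abs_le.1 (hK π)).1⟩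

end Env

end STARC

end

/-!
The return `J_R(π)` is the pairing `∑ x, η x * r x` of the discounted state-action occupancy measure
`η` of `π` with the expected reward `r(s, a) = 𝔼[R(s, a, S')]` (`Env.IsOccupancy.J_eq`). The
occupancy measures of policies are the nonnegative weights that satisfy the flow equation, which is
an affine equation (`Env.exists_isOccupancy`). The solutions of its homogeneous part form the space
`Env.flowDirections`, the orthogonal complement of the changes that potential shaping makes to the
expected reward (`Env.mem_flowDirections_iff`). Hence the orthogonal projection `Env.flowReward R`
of the expected reward to this space determines all differences `J_R(π) - J_R(π')`, and it vanishes
precisely when `R` differs from `0` by potential shaping and `S'`-redistribution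
(`Env.flowReward_eq_zero_iff`), that is, when `c R = 0` for a canonicalisation function `c`.

As every state is reachable, the occupancy measure of the uniform policy is positive, so that every
sufficiently short vector `v` of `flowDirections` arises as the difference between the occupancy
measure of some policy and that of the uniform one (`Env.exists_J_sub_J_eq_inner`). For two
standardised rewards with flow components `x₁` and `x₂`, let `w = x₁ - t • x₂`, where `t • x₂` is
the point nearest to `x₁` on the ray spanned by `x₂`. Then `⟪w, x₂⟫ ≤ 0` and `⟪w, x₁⟫ = ‖w‖ ^ 2`, so
moving in the direction of `w` does not help the second reward and helps the first one at the rate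
`‖w‖`. As standardised rewards are unit vectors for the norm `n` or zero, `‖w‖` bounds their
distance up to a constant (`IsNormOn.map_standardise_sub_le`). This yields
`Env.IsCanonicalisation.exists_regret`, a regret bound proportional to `n (c R₁)`, which in turn
bounds the range of `J_{R₁}` (`Env.rangeJ_le`). If two rewards order the policies in the same way,
then the regret in this bound cannot be positive, so either their distance is `0` or both
canonicalised rewards vanish.
-/

noncomputable section

open MeasureTheory ProbabilityTheory

/-! ### Sums over probability mass functions, trajectories and linear maps -/

theorem PMF.sum_toReal_eq_one {α : Type*} [Fintype α] (p : PMF α) :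
    ∑ x, (p x).toReal = 1 := by
  rw [← ENNReal.toReal_sum fun x _ => p.apply_ne_top x, ← tsum_fintype (L := .unconditional _),
    p.tsum_coe, ENNReal.toReal_one]

/-- The first point of a trajectory is distributed according to the initial distribution. -/
theorem ProbabilityTheory.Kernel.map_eval_zero_trajMeasure {X : ℕ → Type*}
    [∀ n, MeasurableSpace (X n)] {μ : Measure (X 0)}
    {κ : (n : ℕ) → Kernel (Π i : Finset.Iic n, X i) (X (n + 1))} [∀ n, IsMarkovKernel (κ n)] :
    (Kernel.trajMeasure μ κ).map (fun ξ => ξ 0) = μ := by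
  let e : (Π i : Finset.Iic 0, X i) → X 0 := fun x => x ⟨0, Finset.mem_Iic.2 le_rfl⟩
  let j : X 0 → Π i : Finset.Iic 0, X i :=
    (MeasurableEquiv.piUnique fun i : Finset.Iic 0 => X i).symm
  have he : Measurable e := measurable_pi_apply _
  have hj : Measurable j := MeasurableEquiv.measurable _
  have h : (Kernel.trajMeasure μ κ).map (Preorder.frestrictLe 0) = μ.map j := by
    rw [Kernel.trajMeasure, Measure.map_comp _ _ (by fun_prop), Kernel.traj_map_frestrictLe,
      Kernel.partialTraj_self, Measure.id_comp]
    rfl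
  calc (Kernel.trajMeasure μ κ).map (fun ξ => ξ 0)
      = ((Kernel.trajMeasure μ κ).map (Preorder.frestrictLe 0)).map e :=
        (Measure.map_map he (Preorder.measurable_frestrictLe 0)).symm
    _ = (μ.map j).map e := by rw [h]
    _ = μ.map id := Measure.map_map he hj
    _ = μ := Measure.map_id

theorem LinearMap.exists_norm_le_mul_norm {V F : Type*} [NormedAddCommGroup V]
    [NormedSpace ℝ V] [FiniteDimensional ℝ V] [NormedAddCommGroup F] [NormedSpace ℝ F]
    (f : V →ₗ[ℝ] F) : ∃ C : ℝ, 0 < C ∧ ∀ x, ‖f x‖ ≤ C * ‖x‖ := by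
  refine ⟨‖LinearMap.toContinuousLinearMap f‖ + 1, by positivity, fun x => ?_⟩
  refine ((LinearMap.toContinuousLinearMap f).le_opNorm x).trans ?_
  gcongr
  linarith

namespace STARC

open scoped RealInnerProductSpace

/-! ### Norms on subspaces -/

namespace IsNormOn

variable {V : Type*} [AddCommGroup V] [Module ℝ V] {W : Submodule ℝ V} {n n' : V → ℝ}

theorem mono {W' : Submodule ℝ V} (h : IsNormOn W n) (hW : W' ≤ W) : IsNormOn W' n where
  nonneg x hx := h.nonneg x (hW hx)
  eq_zero_iff x hx := h.eq_zero_iff x (hW hx)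
  smul r x hx := h.smul r x (hW hx)
  add_le x hx y hy := h.add_le x (hW hx) y (hW hy)

theorem comp_linearMap {F : Type*} [NormedAddCommGroup F] [NormedSpace ℝ F] (f : V →ₗ[ℝ] F)
    (hf : ∀ x ∈ W, f x = 0 → x = 0) : IsNormOn W fun x => ‖f x‖ where
  nonneg _ _ := norm_nonneg _
  eq_zero_iff x hx := by
    rw [norm_eq_zero]
    exact ⟨hf x hx, fun h => by rw [h, map_zero]⟩
  smul r x _ := by rw [map_smul, norm_smul, Real.norm_eq_abs]
  add_le x _ y _ := by
    rw [map_add]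
    exact norm_add_le _ _

/-- A norm on `W` satisfies the axioms of a normed space structure on the type of the elements of
`W`. -/
theorem core (h : IsNormOn W n) :
    let _ : Norm W := ⟨fun x => n x⟩
    NormedSpace.Core ℝ W :=
  let _ : Norm W := ⟨fun x => n x⟩
  { norm_nonneg := fun x => h.nonneg x x.2
    norm_smul := fun r x => h.smul r x x.2
    norm_triangle := fun x y => h.add_le x x.2 y y.2
    norm_eq_zero_iff := fun x => by
      rw [← Submodule.coe_eq_zero]
      exact h.eq_zero_iff x x.2 }

/-- Any two norms on a finite-dimensional subspace are comparable. -/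
theorem exists_le_mul [FiniteDimensional ℝ W] (h : IsNormOn W n) (h' : IsNormOn W n') :
    ∃ C : ℝ, 0 < C ∧ ∀ x ∈ W, n x ≤ C * n' x := by
  -- `W` carries both norms, so the instances of domain and codomain are given by hand.
  let i₁ : Norm W := ⟨fun x => n x⟩
  let g₁ : NormedAddCommGroup W := .ofCore h.core
  let s₁ : NormedSpace ℝ W := .ofCore h.core
  let i₂ : Norm W := ⟨fun x => n' x⟩
  let g₂ : NormedAddCommGroup W := .ofCore h'.core
  let s₂ : NormedSpace ℝ W := .ofCore h'.core
  obtain ⟨C, hC, hle⟩ := @LinearMap.exists_norm_le_mul_norm W W g₂ s₂ _ g₁ s₁ LinearMap.id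
  exact ⟨C, hC, fun x hx => hle ⟨x, hx⟩⟩

theorem map_neg (h : IsNormOn W n) {x : V} (hx : x ∈ W) : n (-x) = n x := by
  rw [← neg_one_smul ℝ, h.smul _ _ hx, abs_neg, abs_one, one_mul]

/-- The distance of two unit vectors is at most twice the distance of the first to any point of the
ray that the second spans. -/
theorem map_sub_le_two_mul (h : IsNormOn W n) {x y : V} (hx : x ∈ W) (hy : y ∈ W)
    (hx1 : n x = 1) (hy1 : n y = 1) {t : ℝ} (ht : 0 ≤ t) : n (x - y) ≤ 2 * n (x - t • y) := by
  have hxy : x - t • y ∈ W := W.sub_mem hx (W.smul_mem t hy)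
  have hty : n (t • y) = t := by rw [h.smul t y hy, hy1, mul_one, abs_of_nonneg ht]
  -- The norms of `x` and `t • y` are `1` and `t`.
  have h1 : |t - 1| ≤ n (x - t • y) := by
    have ha := h.add_le _ hxy _ (W.smul_mem t hy)
    have hb := h.add_le _ hx _ (W.neg_mem hxy)
    rw [h.map_neg hxy] at hb
    rw [sub_add_cancel, hty] at ha
    rw [neg_sub, add_sub_cancel, hty] at hb
    rw [abs_le]
    constructor <;> linarith
  have h2 := h.add_le _ hxy _ (W.smul_mem (t - 1) hy)
  rw [h.smul _ _ hy, hy1, mul_one] at h2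
  have h3 : x - t • y + (t - 1) • y = x - y := by module
  rw [h3] at h2
  linarith

end IsNormOn

section Standardise

variable {V : Type*} [AddCommGroup V] [Module ℝ V] {c : V →ₗ[ℝ] V} {n : V → ℝ}

theorem standardise_mem_range (c : V →ₗ[ℝ] V) (n : V → ℝ) (R : V) :
    standardise c n R ∈ LinearMap.range c := by
  rw [standardise]
  split_ifs
  · exact Submodule.smul_mem _ _ ⟨R, rfl⟩
  · exact ⟨R, rfl⟩

namespace IsNormOn

theorem standardise_eq_zero (hn : IsNormOn (LinearMap.range c) n) {R : V} (h : n (c R) = 0) :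
    standardise c n R = 0 := by
  rw [standardise, if_neg (not_not.2 h)]
  exact (hn.eq_zero_iff _ ⟨R, rfl⟩).1 h

theorem smul_standardise (hn : IsNormOn (LinearMap.range c) n) (R : V) :
    n (c R) • standardise c n R = c R := by
  by_cases h : n (c R) = 0
  · rw [hn.standardise_eq_zero h, smul_zero, (hn.eq_zero_iff _ ⟨R, rfl⟩).1 h]
  · rw [standardise, if_pos h, smul_smul, mul_inv_cancel₀ h, one_smul]

theorem map_standardise (hn : IsNormOn (LinearMap.range c) n) {R : V} (h : n (c R) ≠ 0) :
    n (standardise c n R) = 1 := by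
  rw [standardise, if_pos h, hn.smul _ _ ⟨R, rfl⟩,
    abs_of_nonneg (inv_nonneg.2 (hn.nonneg _ ⟨R, rfl⟩)), inv_mul_cancel₀ h]

/-- As `map_sub_le_two_mul`, where standardised rewards may also vanish. -/
theorem map_standardise_sub_le (hn : IsNormOn (LinearMap.range c) n) {R : V} (R' : V)
    (h : n (c R) ≠ 0) {t : ℝ} (ht : 0 ≤ t) :
    n (standardise c n R - standardise c n R') ≤
      2 * n (standardise c n R - t • standardise c n R') := by
  by_cases h' : n (c R') = 0
  -- Here the ray is the origin.
  · rw [hn.standardise_eq_zero h', smul_zero, sub_zero, hn.map_standardise h]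
    norm_num
  · exact hn.map_sub_le_two_mul (standardise_mem_range c n R) (standardise_mem_range c n R')
      (hn.map_standardise h) (hn.map_standardise h') ht

end IsNormOn

end Standardise

/-- Subtracting from `a` its nearest point on the ray of the nonnegative multiples of `b` leaves a
vector that makes no acute angle with `b` and is orthogonal to the point subtracted. -/
theorem exists_inner_sub_smul_nonpos {H : Type*} [NormedAddCommGroup H] [InnerProductSpace ℝ H]
    (a b : H) : ∃ t : ℝ, 0 ≤ t ∧ ⟪a - t • b, b⟫ ≤ 0 ∧ ⟪a - t • b, a⟫ = ‖a - t • b‖ ^ 2 := by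
  rcases le_or_gt ⟪a, b⟫ 0 with h | h
  · exact ⟨0, le_rfl, by simpa using h, by simp⟩
  · have hb : ‖b‖ ^ 2 ≠ 0 := by
      rintro hb
      rw [sq_eq_zero_iff, norm_eq_zero] at hb
      simp [hb] at h
    have h0 : ⟪a - (⟪a, b⟫ / ‖b‖ ^ 2) • b, b⟫ = 0 := by
      rw [inner_sub_left, real_inner_smul_left, real_inner_self_eq_norm_sq, div_mul_cancel₀ _ hb,
        sub_self]
    refine ⟨⟪a, b⟫ / ‖b‖ ^ 2, by positivity, h0.le, ?_⟩
    -- `a - t • b` is orthogonal to `b`, so pairing it with `a` or with itself is the same.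
    rw [← real_inner_self_eq_norm_sq (_ - _)]
    conv_rhs => rw [inner_sub_right, real_inner_smul_right, h0, mul_zero, sub_zero]

namespace Env

variable {S A : Type*} [Fintype S] (E : Env S A)

/-! ### Occupancy measures and the flow equation -/

theorem toReal_stepLaw_apply (π : Policy S A) (p : PMF S) (s : S) (a : A) :
    (stepLaw π p (s, a)).toReal = (p s).toReal * (π s a).toReal := by
  classical
  have h : ∀ s' : S, (π s').map (fun b => (s', b)) (s, a) = if s' = s then π s a else 0 := by
    intro s'
    rw [PMF.map_apply]
    split_ifs with hs
    · subst hs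
      rw [tsum_eq_single a]
      · simp
      · intro b hb
        simp [hb.symm]
    · simp [Ne.symm hs]
  rw [stepLaw, PMF.bind_apply, tsum_fintype, ← ENNReal.toReal_mul]
  simp [h]

variable [Fintype A]

/-- The inflow of a state `s` under the state-action weights `η`: the initial probability of `s`
plus the discounted weight that the transitions carry to `s`. -/
def inflow (η : S × A → ℝ) (s : S) : ℝ :=
  (E.μ₀ s).toReal + E.γ * ∑ x, η x * (E.τ x.1 x.2 s).toReal

/-- `η` is the discounted state-action occupancy measure of the policy `π`, expressed by the
equation that determines it. -/
def IsOccupancy (π : Policy S A) (η : S × A → ℝ) : Prop :=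
  ∀ s a, η (s, a) = E.inflow η s * (π s a).toReal

/-- The expected reward `𝔼[R(s, a, S')]` of a state-action pair, for `S' ∼ τ(s, a)`. -/
def expReward (R : Reward S A) (x : S × A) : ℝ :=
  ∑ s', (E.τ x.1 x.2 s').toReal * R x.1 x.2 s'

variable {E}

theorem IsOccupancy.sum_eq {π : Policy S A} {η : S × A → ℝ} (h : E.IsOccupancy π η) (s : S) :
    ∑ a, η (s, a) = E.inflow η s := by
  simp only [h s, ← Finset.mul_sum, PMF.sum_toReal_eq_one, mul_one]

variable (E) in
theorem sum_sum_mul_τ (η : S × A → ℝ) :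
    ∑ s, ∑ x, η x * (E.τ x.1 x.2 s).toReal = ∑ x, η x := by
  rw [Finset.sum_comm]
  simp [← Finset.mul_sum, PMF.sum_toReal_eq_one]

theorem IsOccupancy.sum_univ {π : Policy S A} {η : S × A → ℝ} (h : E.IsOccupancy π η) :
    ∑ x, η x = (1 - E.γ)⁻¹ := by
  have h1 : ∑ x, η x = 1 + E.γ * ∑ x, η x := by
    conv_lhs => rw [Fintype.sum_prod_type]
    simp only [h.sum_eq, inflow, Finset.sum_add_distrib, ← Finset.mul_sum, sum_sum_mul_τ,
      PMF.sum_toReal_eq_one]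
  have h2 : (1 - E.γ) * ∑ x, η x = 1 := by linarith
  exact eq_inv_of_mul_eq_one_right h2

/-- The equation of an occupancy measure has at most one solution, as its linear part is a
contraction with factor `γ` in the `ℓ¹` norm. -/
theorem IsOccupancy.unique {π : Policy S A} {η η' : S × A → ℝ} (h : E.IsOccupancy π η)
    (h' : E.IsOccupancy π η') : η = η' := by
  have key : ∀ x, |η x - η' x| ≤
      (E.γ * ∑ y, |η y - η' y| * (E.τ y.1 y.2 x.1).toReal) * (π x.1 x.2).toReal := by
    rintro ⟨s, a⟩
    rw [h s a, h' s a, ← sub_mul, abs_mul, abs_of_nonneg (ENNReal.toReal_nonneg (a := π s a))]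
    gcongr
    rw [inflow, inflow, add_sub_add_left_eq_sub, ← mul_sub, abs_mul, abs_of_pos E.γ_pos,
      ← Finset.sum_sub_distrib]
    gcongr
    · exact E.γ_pos.le
    refine (Finset.abs_sum_le_sum_abs _ _).trans (Finset.sum_le_sum fun y _ => ?_)
    rw [← sub_mul, abs_mul, abs_of_nonneg (ENNReal.toReal_nonneg (a := E.τ y.1 y.2 s))]
  have hsum : ∑ x, |η x - η' x| ≤ E.γ * ∑ x, |η x - η' x| := by
    refine (Finset.sum_le_sum fun x _ => key x).trans_eq ?_
    rw [Fintype.sum_prod_type]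
    simp only [← Finset.mul_sum, PMF.sum_toReal_eq_one, mul_one, sum_sum_mul_τ]
  have h0 : 0 ≤ ∑ x, |η x - η' x| := Finset.sum_nonneg fun _ _ => abs_nonneg _
  have h1 : ∑ x, |η x - η' x| = 0 := by nlinarith [E.γ_lt_one]
  funext x
  have := (Finset.sum_eq_zero_iff_of_nonneg fun _ _ => abs_nonneg _).1 h1 x (Finset.mem_univ x)
  exact sub_eq_zero.1 (abs_eq_zero.1 this)

/-- Nonnegative weights that satisfy the flow equation are the occupancy measure of a policy: take
each action with the probability proportional to its weight. -/
theorem exists_isOccupancy [Nonempty A] {η : S × A → ℝ} (h0 : ∀ x, 0 ≤ η x)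
    (hflow : ∀ s, ∑ a, η (s, a) = E.inflow η s) : ∃ π : Policy S A, E.IsOccupancy π η := by
  classical
  have hD : ∀ s, 0 ≤ E.inflow η s := fun s => hflow s ▸ Finset.sum_nonneg fun a _ => h0 _
  have hsum : ∀ s, E.inflow η s ≠ 0 → ∑ a, ENNReal.ofReal (η (s, a) / E.inflow η s) = 1 := by
    intro s hs
    rw [← ENNReal.ofReal_sum_of_nonneg fun a _ => div_nonneg (h0 _) (hD s), ← Finset.sum_div,
      hflow, div_self hs, ENNReal.ofReal_one]
  -- A state without inflow has no weight, so the action taken there does not matter.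
  refine ⟨fun s => if hs : E.inflow η s = 0 then PMF.pure (Classical.arbitrary A)
    else PMF.ofFintype _ (hsum s hs), fun s a => ?_⟩
  by_cases hs : E.inflow η s = 0
  · have := (Finset.sum_eq_zero_iff_of_nonneg fun a _ => h0 (s, a)).1 ((hflow s).trans hs) a
      (Finset.mem_univ a)
    rw [hs, this, zero_mul]
  · simp only [hs, dif_neg, not_false_eq_true, PMF.ofFintype_apply]
    rw [ENNReal.toReal_ofReal (div_nonneg (h0 _) (hD s)), mul_div_cancel₀ _ hs]

/-- If every state is reachable, then the occupancy measure of a policy that takes every action with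
positive probability charges every state-action pair. -/
theorem IsOccupancy.pos (hreach : ∀ s, E.IsReachable s) {π : Policy S A}
    (hπ : ∀ s a, 0 < (π s a).toReal) {η : S × A → ℝ} (h0 : ∀ x, 0 ≤ η x)
    (h : E.IsOccupancy π η) (x : S × A) : 0 < η x := by
  have hterm : ∀ s, ∀ y, 0 ≤ η y * (E.τ y.1 y.2 s).toReal := fun s y =>
    mul_nonneg (h0 y) ENNReal.toReal_nonneg
  have hpos : ∀ {p : PMF S} {s}, s ∈ p.support → 0 < (p s).toReal := fun {p s} hs =>
    ENNReal.toReal_pos ((p.mem_support_iff s).1 hs) (p.apply_ne_top s)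
  suffices hs : ∀ s, 0 < E.inflow η s by
    rw [show η x = _ from h x.1 x.2]
    exact mul_pos (hs _) (hπ _ _)
  intro s
  obtain ⟨s₀, hs₀, hpath⟩ := hreach s
  induction hpath with
  | refl =>
    exact add_pos_of_pos_of_nonneg (hpos hs₀)
      (mul_nonneg E.γ_pos.le (Finset.sum_nonneg fun y _ => hterm _ y))
  | @tail y z _ hstep ih =>
    obtain ⟨a, ha⟩ := hstep
    refine add_pos_of_nonneg_of_pos ENNReal.toReal_nonneg (mul_pos E.γ_pos ?_)
    refine Finset.sum_pos' (fun w _ => hterm _ w) ⟨(y, a), Finset.mem_univ _, ?_⟩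
    refine mul_pos ?_ (hpos ha)
    rw [h y a]
    exact mul_pos ih (hπ _ _)

section Trajectories

/-! ### The return of a policy in terms of its occupancy measure -/

variable [MeasurableSpace S] [MeasurableSingletonClass S]
  [MeasurableSpace A] [MeasurableSingletonClass A]

variable (E) (π : Policy S A)

/-- The probability that a trajectory of `π` passes through the state-action pair `x` at time
`t`. -/
def visitProb (t : ℕ) (x : S × A) : ℝ := (E.trajLaw π).real {ξ | ξ t = x}

theorem integral_comp_eval (t : ℕ) (g : S × A → ℝ) :
    ∫ ξ, g (ξ t) ∂(E.trajLaw π) = ∑ x, E.visitProb π t x * g x := by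
  have hm : Measurable fun ξ : ℕ → S × A => ξ t := measurable_pi_apply t
  rw [← integral_map (φ := fun ξ : ℕ → S × A => ξ t) hm.aemeasurable
    (measurable_of_countable g).aestronglyMeasurable]
  have : IsProbabilityMeasure ((E.trajLaw π).map fun ξ : ℕ → S × A => ξ t) :=
    Measure.isProbabilityMeasure_map hm.aemeasurable
  rw [integral_fintype .of_finite]
  refine Finset.sum_congr rfl fun x _ => ?_
  rw [map_measureReal_apply hm (measurableSet_singleton x), smul_eq_mul]
  rfl

/-- The Markov property: the expectation of a function of two consecutive state-action pairs. -/
theorem integral_comp_eval_succ (t : ℕ) (f : S × A → S × A → ℝ) :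
    ∫ ξ, f (ξ t) (ξ (t + 1)) ∂(E.trajLaw π) =
      ∑ x, E.visitProb π t x *
        ∑ y : S × A, (E.τ x.1 x.2 y.1).toReal * (π y.1 y.2).toReal * f x y := by
  have hf : Measurable fun z : (Finset.Iic t → S × A) × (S × A) =>
      f (z.1 ⟨t, Finset.mem_Iic.2 le_rfl⟩) z.2 := by
    have : Measurable fun z : (S × A) × (S × A) => f z.1 z.2 := measurable_of_countable _
    exact this.comp (f := fun z : (Finset.Iic t → S × A) × (S × A) =>
      (z.1 ⟨t, Finset.mem_Iic.2 le_rfl⟩, z.2)) (by fun_prop)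
  have hm : Measurable fun ξ : ℕ → S × A =>
      (Preorder.frestrictLe (π := fun _ => S × A) t ξ, ξ (t + 1)) := by
    fun_prop
  have hmap := Kernel.map_frestrictLe_trajMeasure_compProd_eq_map_trajMeasure
    (X := fun _ => S × A) (μ₀ := (stepLaw π E.μ₀).toMeasure) (κ := E.stepKernel π) (a := t)
  have : IsProbabilityMeasure ((E.trajLaw π).map (Preorder.frestrictLe (π := fun _ => S × A) t)) :=
    Measure.isProbabilityMeasure_map (by fun_prop)
  obtain ⟨B, hB⟩ := (Set.finite_range fun z : (S × A) × (S × A) => ‖f z.1 z.2‖).bddAbove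
  have hint : Integrable (fun z : (Finset.Iic t → S × A) × (S × A) =>
      f (z.1 ⟨t, Finset.mem_Iic.2 le_rfl⟩) z.2)
      ((E.trajLaw π).map (Preorder.frestrictLe (π := fun _ => S × A) t) ⊗ₘ E.stepKernel π t) :=
    .of_bound hf.aestronglyMeasurable B (.of_forall fun z => hB ⟨(_, z.2), rfl⟩)
  have h1 := Measure.integral_compProd hint
  have hmap' : (E.trajLaw π).map (Preorder.frestrictLe (π := fun _ => S × A) t) ⊗ₘ
      E.stepKernel π t = (E.trajLaw π).map fun ξ : ℕ → S × A =>
        (Preorder.frestrictLe (π := fun _ => S × A) t ξ, ξ (t + 1)) := hmap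
  rw [hmap', integral_map hm.aemeasurable hf.aestronglyMeasurable] at h1
  refine h1.trans ?_
  have hk : ∀ h : Finset.Iic t → S × A,
      ∫ y, f (h ⟨t, Finset.mem_Iic.2 le_rfl⟩) y ∂(E.stepKernel π t h) =
        ∑ y : S × A, (E.τ (h ⟨t, Finset.mem_Iic.2 le_rfl⟩).1 (h ⟨t, Finset.mem_Iic.2 le_rfl⟩).2
          y.1).toReal * (π y.1 y.2).toReal * f (h ⟨t, Finset.mem_Iic.2 le_rfl⟩) y := by
    intro h
    refine (PMF.integral_eq_sum _ _).trans (Finset.sum_congr rfl fun y _ => ?_)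
    rw [smul_eq_mul, ← toReal_stepLaw_apply]
  simp only [hk]
  rw [integral_map (by fun_prop) (measurable_of_countable _).aestronglyMeasurable]
  exact E.integral_comp_eval π t fun x =>
    ∑ y : S × A, (E.τ x.1 x.2 y.1).toReal * (π y.1 y.2).toReal * f x y

theorem visitProb_zero (s : S) (a : A) :
    E.visitProb π 0 (s, a) = (E.μ₀ s).toReal * (π s a).toReal := by
  have h : (E.trajLaw π).map (fun ξ => ξ 0) = (stepLaw π E.μ₀).toMeasure :=
    Kernel.map_eval_zero_trajMeasure (X := fun _ => S × A)
  rw [visitProb, ← toReal_stepLaw_apply, ← PMF.toMeasure_apply_singleton _ _ (.singleton _), ← h,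
    Measure.map_apply (measurable_pi_apply 0) (.singleton _)]
  rfl

theorem visitProb_succ (t : ℕ) (s : S) (a : A) :
    E.visitProb π (t + 1) (s, a) =
      (∑ x, E.visitProb π t x * (E.τ x.1 x.2 s).toReal) * (π s a).toReal := by
  classical
  have h1 := E.integral_comp_eval π (t + 1) (fun y => if y = (s, a) then 1 else 0)
  have h2 := E.integral_comp_eval_succ π t (fun _ y => if y = (s, a) then 1 else 0)
  rw [h1] at h2
  simp only [mul_ite, mul_one, mul_zero, Finset.sum_ite_eq', Finset.mem_univ, if_true] at h2
  rw [h2, Finset.sum_mul]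
  exact Finset.sum_congr rfl fun x _ => by ring

/-- The discounted expected number of visits of a trajectory of `π` to a state-action pair. -/
def occupancy (x : S × A) : ℝ := ∑' t : ℕ, E.γ ^ t * E.visitProb π t x

theorem visitProb_nonneg (t : ℕ) (x : S × A) : 0 ≤ E.visitProb π t x := measureReal_nonneg

theorem occupancy_nonneg (x : S × A) : 0 ≤ E.occupancy π x :=
  tsum_nonneg fun t => mul_nonneg (pow_nonneg E.γ_pos.le t) (E.visitProb_nonneg π t x)

theorem summable_visitProb (x : S × A) : Summable fun t : ℕ => E.γ ^ t * E.visitProb π t x := by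
  refine .of_norm_bounded (E.summable_geometric_mul 1) fun t => ?_
  rw [norm_mul, norm_pow, Real.norm_of_nonneg E.γ_pos.le,
    Real.norm_of_nonneg (E.visitProb_nonneg π t x)]
  exact mul_le_mul_of_nonneg_left measureReal_le_one (pow_nonneg E.γ_pos.le t)

theorem hasSum_occupancy_mul (g : S × A → ℝ) :
    HasSum (fun t : ℕ => E.γ ^ t * ∑ x, E.visitProb π t x * g x) (∑ x, E.occupancy π x * g x) := by
  simp only [Finset.mul_sum, ← mul_assoc]
  exact hasSum_sum fun x _ => (E.summable_visitProb π x).hasSum.mul_right (g x)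

theorem isOccupancy_occupancy : E.IsOccupancy π (E.occupancy π) := by
  intro s a
  rw [occupancy, (E.summable_visitProb π _).tsum_eq_zero_add]
  simp only [visitProb_zero, visitProb_succ, pow_zero, one_mul, inflow,
    ← (E.hasSum_occupancy_mul π _).tsum_eq]
  rw [add_mul, ← tsum_mul_left, ← tsum_mul_right]
  congr 2
  funext t
  ring

theorem J_eq_sum_occupancy (R : Reward S A) :
    E.J R π = ∑ x, E.occupancy π x * E.expReward R x := by
  have hint : ∀ t : ℕ, ∫ ξ, E.γ ^ t * R (ξ t).1 (ξ t).2 (ξ (t + 1)).1 ∂(E.trajLaw π) =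
      E.γ ^ t * ∑ x, E.visitProb π t x * E.expReward R x := by
    intro t
    rw [integral_const_mul, E.integral_comp_eval_succ π t fun x y => R x.1 x.2 y.1]
    congr 1
    refine Finset.sum_congr rfl fun x _ => ?_
    rw [expReward, Fintype.sum_prod_type]
    congr 1
    refine Finset.sum_congr rfl fun s' _ => ?_
    simp only [mul_right_comm _ _ (R x.1 x.2 s')]
    rw [← Finset.mul_sum, PMF.sum_toReal_eq_one, mul_one]
  rw [← (E.hasSum_occupancy_mul π _).tsum_eq, J]
  simp only [← hint]
  obtain ⟨B, hB⟩ := exists_bound R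
  have hbound := fun (t : ℕ) (ξ : ℕ → S × A) => E.norm_ret_term_le hB ξ t
  have hmeas : ∀ t : ℕ, Measurable fun ξ : ℕ → S × A =>
      E.γ ^ t * R (ξ t).1 (ξ t).2 (ξ (t + 1)).1 := fun t =>
    (measurable_of_countable fun z : (S × A) × (S × A) => E.γ ^ t * R z.1.1 z.1.2 z.2.1).comp
      (f := fun ξ : ℕ → S × A => (ξ t, ξ (t + 1))) (by fun_prop)
  refine (hasSum_integral_of_dominated_convergence (fun t _ => E.γ ^ t * B)
    (fun t => (hmeas t).aestronglyMeasurable) (fun t => .of_forall (hbound t))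
    (.of_forall fun _ => E.summable_geometric_mul B) (integrable_const _)
    (.of_forall fun ξ => (E.summable_ret R ξ).hasSum)).tsum_eq.symm

variable {E π} in
theorem IsOccupancy.J_eq {η : S × A → ℝ} (h : E.IsOccupancy π η) (R : Reward S A) :
    E.J R π = ∑ x, η x * E.expReward R x := by
  rw [J_eq_sum_occupancy, h.unique (E.isOccupancy_occupancy π)]

end Trajectories

variable (E)

/-! ### Flow directions -/

/-- The change `(s, a) ↦ γ 𝔼[Φ(S')] - Φ(s)` of the expected reward under potential shaping with the
potential `Φ`. -/
def shaping : (S → ℝ) →ₗ[ℝ] EuclideanSpace ℝ (S × A) where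
  toFun Φ := WithLp.toLp 2 fun x => E.γ * ∑ s', (E.τ x.1 x.2 s').toReal * Φ s' - Φ x.1
  map_add' Φ Ψ := by
    ext x
    simp only [Pi.add_apply, PiLp.add_apply, mul_add, Finset.sum_add_distrib]
    ring
  map_smul' r Φ := by
    ext x
    simp only [Pi.smul_apply, PiLp.smul_apply, smul_eq_mul, RingHom.id_apply, mul_sub,
      Finset.mul_sum]
    congr 1
    exact Finset.sum_congr rfl fun _ _ => by ring

/-- The directions in which the occupancy measures of policies vary: the orthogonal complement of
the changes of the expected reward under potential shaping. -/
def flowDirections : Submodule ℝ (EuclideanSpace ℝ (S × A)) := (LinearMap.range E.shaping)ᗮ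

theorem mem_flowDirections_iff {v : EuclideanSpace ℝ (S × A)} :
    v ∈ E.flowDirections ↔ ∀ s, ∑ a, v (s, a) = E.γ * ∑ x, v x * (E.τ x.1 x.2 s).toReal := by
  classical
  have key : ∀ Φ : S → ℝ, ⟪E.shaping Φ, v⟫ =
      ∑ s, (E.γ * ∑ x, v x * (E.τ x.1 x.2 s).toReal - ∑ a, v (s, a)) * Φ s := by
    intro Φ
    simp only [shaping, LinearMap.coe_mk, AddHom.coe_mk, PiLp.inner_apply, RCLike.inner_apply,
      conj_trivial, mul_sub, sub_mul, Finset.sum_sub_distrib]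
    congr 1
    · simp only [Finset.mul_sum, Finset.sum_mul]
      rw [Finset.sum_comm]
      exact Finset.sum_congr rfl fun _ _ => Finset.sum_congr rfl fun _ _ => by ring
    · simp only [Fintype.sum_prod_type, Finset.sum_mul]
  rw [flowDirections, Submodule.mem_orthogonal]
  constructor
  · intro h s
    have := h _ ⟨Pi.single s 1, rfl⟩
    rw [key] at this
    simp only [Pi.single_apply, mul_ite, mul_one, mul_zero, Finset.sum_ite_eq', Finset.mem_univ,
      if_true] at this
    linarith
  · rintro h _ ⟨Φ, rfl⟩
    rw [key]
    simp [h]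

/-- The component of the expected reward in `flowDirections`: the part of a reward function that
potential shaping does not change. -/
def flowReward : Reward S A →ₗ[ℝ] EuclideanSpace ℝ (S × A) :=
  E.flowDirections.starProjection.toLinearMap ∘ₗ
    { toFun := fun R => WithLp.toLp 2 (E.expReward R)
      map_add' := fun R R' => by
        ext x
        simp only [expReward, Pi.add_apply, PiLp.add_apply, mul_add, Finset.sum_add_distrib]
      map_smul' := fun r R => by
        ext x
        simp only [expReward, Pi.smul_apply, PiLp.smul_apply, smul_eq_mul, RingHom.id_apply,
          Finset.mul_sum]
        exact Finset.sum_congr rfl fun _ _ => by ring }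

theorem flowReward_mem (R : Reward S A) : E.flowReward R ∈ E.flowDirections :=
  Submodule.starProjection_apply_mem _ _

variable {E} in
theorem inner_flowReward {v : EuclideanSpace ℝ (S × A)} (hv : v ∈ E.flowDirections)
    (R : Reward S A) : ⟪v, E.flowReward R⟫ = ∑ x, v x * E.expReward R x := by
  have h : ⟪v, E.flowReward R⟫ = ⟪v, WithLp.toLp 2 (E.expReward R)⟫ := by
    simp only [flowReward, LinearMap.comp_apply, LinearMap.coe_mk, AddHom.coe_mk,
      ContinuousLinearMap.coe_coe]
    rw [← Submodule.inner_starProjection_left_eq_right,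
      Submodule.starProjection_eq_self_iff.2 hv]
  rw [h]
  simp [PiLp.inner_apply, mul_comm]

/-- As the subspace of shaping changes is its own double orthogonal complement, a reward without
flow component is a shaping change up to redistribution. -/
theorem flowReward_eq_zero_iff (R : Reward S A) : E.flowReward R = 0 ↔ E.Differ 0 R := by
  have h : E.flowReward R = 0 ↔ WithLp.toLp 2 (E.expReward R) ∈ LinearMap.range E.shaping := by
    rw [flowReward, LinearMap.comp_apply, ContinuousLinearMap.coe_coe,
      Submodule.starProjection_apply_eq_zero_iff, flowDirections, Submodule.orthogonal_orthogonal]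
    rfl
  have hsum : ∀ (Φ : S → ℝ) s a, ∑ s', (E.τ s a s').toReal * (E.γ * Φ s' - Φ s) =
      E.shaping Φ (s, a) := by
    intro Φ s a
    simp only [shaping, LinearMap.coe_mk, AddHom.coe_mk, mul_sub, Finset.sum_sub_distrib,
      ← Finset.sum_mul, PMF.sum_toReal_eq_one, one_mul, Finset.mul_sum]
    congr 1
    exact Finset.sum_congr rfl fun _ _ => by ring
  rw [h]
  constructor
  · rintro ⟨Φ, hΦ⟩
    refine ⟨fun s _ s' => E.γ * Φ s' - Φ s, ⟨Φ, fun s a s' => by simp⟩, fun s a => ?_⟩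
    rw [hsum, hΦ]
    rfl
  · rintro ⟨R', ⟨Φ, hΦ⟩, hR⟩
    refine ⟨Φ, ?_⟩
    ext ⟨s, a⟩
    rw [← hsum]
    refine Eq.trans ?_ (hR s a)
    simp [hΦ]

/-! ### Canonicalisation functions -/

namespace IsCanonicalisation

variable {E} {c : Reward S A →ₗ[ℝ] Reward S A}

theorem flowReward_eq_zero_iff (hc : E.IsCanonicalisation c) (R : Reward S A) :
    E.flowReward R = 0 ↔ c R = 0 := by
  rw [Env.flowReward_eq_zero_iff, ← hc.eq_iff, map_zero, eq_comm]

theorem apply_apply {S A : Type*} [Fintype S] {E : Env S A} {c : Reward S A →ₗ[ℝ] Reward S A}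
    (hc : E.IsCanonicalisation c) (R : Reward S A) : c (c R) = c R :=
  ((hc.eq_iff _ _).2 (hc.differ_self R)).symm

theorem flowReward_apply (hc : E.IsCanonicalisation c) (R : Reward S A) :
    E.flowReward (c R) = E.flowReward R := by
  rw [← sub_eq_zero, ← map_sub, hc.flowReward_eq_zero_iff, map_sub, hc.apply_apply, sub_self]

theorem eq_zero_of_mem_range (hc : E.IsCanonicalisation c) {x : Reward S A}
    (hx : x ∈ LinearMap.range c) (h : E.flowReward x = 0) : x = 0 := by
  obtain ⟨R, rfl⟩ := hx
  rwa [hc.flowReward_eq_zero_iff, hc.apply_apply] at h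

theorem flowReward_eq_smul (hc : E.IsCanonicalisation c) {n : Reward S A → ℝ}
    (hn : IsNormOn (LinearMap.range c) n) (R : Reward S A) :
    E.flowReward R = n (c R) • E.flowReward (standardise c n R) := by
  rw [← map_smul, hn.smul_standardise, hc.flowReward_apply]

theorem isNormOn_norm_flowReward (hc : E.IsCanonicalisation c) :
    IsNormOn (LinearMap.range c) fun x => ‖E.flowReward x‖ :=
  .comp_linearMap E.flowReward fun _ => hc.eq_zero_of_mem_range

end IsCanonicalisation

/-! ### Bounds on the return and on the regret -/

section Evaluation

variable [MeasurableSpace S] [MeasurableSingletonClass S]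
  [MeasurableSpace A] [MeasurableSingletonClass A]

/-- The constant comes from the total mass `(1 - γ)⁻¹` of an occupancy measure. -/
theorem J_sub_J_le (R : Reward S A) (π π' : Policy S A) :
    E.J R π - E.J R π' ≤ 2 * (1 - E.γ)⁻¹ * ‖E.flowReward R‖ := by
  have hη := E.isOccupancy_occupancy π
  have hη' := E.isOccupancy_occupancy π'
  set η := E.occupancy π
  set η' := E.occupancy π'
  have hv : WithLp.toLp 2 (η - η') ∈ E.flowDirections := by
    rw [mem_flowDirections_iff]
    intro s
    simp only [Pi.sub_apply, sub_mul, Finset.sum_sub_distrib, hη.sum_eq, hη'.sum_eq, inflow]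
    ring
  have h1 : E.J R π - E.J R π' = ⟪WithLp.toLp 2 (η - η'), E.flowReward R⟫ := by
    rw [inner_flowReward hv, hη.J_eq, hη'.J_eq, ← Finset.sum_sub_distrib]
    exact Finset.sum_congr rfl fun x _ => (sub_mul _ _ _).symm
  rw [h1, PiLp.inner_apply]
  have h2 : ∀ x, ⟪(WithLp.toLp 2 (η - η') : EuclideanSpace ℝ (S × A)) x, E.flowReward R x⟫ ≤
      (η x + η' x) * ‖E.flowReward R‖ := by
    intro x
    refine (real_inner_le_norm _ _).trans (mul_le_mul ?_ (PiLp.norm_apply_le _ x)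
      (norm_nonneg _) (add_nonneg (E.occupancy_nonneg π x) (E.occupancy_nonneg π' x)))
    refine (norm_sub_le _ _).trans_eq ?_
    rw [Real.norm_of_nonneg (E.occupancy_nonneg π x), Real.norm_of_nonneg (E.occupancy_nonneg π' x)]
  refine (Finset.sum_le_sum fun x _ => h2 x).trans_eq ?_
  rw [← Finset.sum_mul, Finset.sum_add_distrib, hη.sum_univ, hη'.sum_univ, two_mul]

theorem rangeJ_le [Nonempty A] (R : Reward S A) :
    E.rangeJ R ≤ 2 * (1 - E.γ)⁻¹ * ‖E.flowReward R‖ := by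
  have : Nonempty (Policy S A) := ⟨fun _ => PMF.pure (Classical.arbitrary A)⟩
  rw [rangeJ, sub_le_iff_le_add]
  refine ciSup_le fun π => ?_
  rw [← sub_le_iff_le_add']
  refine le_ciInf fun π' => ?_
  linarith [E.J_sub_J_le R π π']

variable {E} in
/-- Every small flow direction is realised by a change of the uniform policy, whose occupancy
measure charges every state-action pair. -/
theorem exists_J_sub_J_eq_inner [Nonempty A] (hreach : ∀ s, E.IsReachable s) :
    ∃ π₀ : Policy S A, ∃ δ > 0, ∀ v ∈ E.flowDirections, ‖v‖ ≤ δ →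
      ∃ π, ∀ R, E.J R π - E.J R π₀ = ⟪v, E.flowReward R⟫ := by
  let π₀ : Policy S A := fun _ => PMF.uniformOfFintype A
  have hη := E.isOccupancy_occupancy π₀
  have hpos : ∀ x, 0 < E.occupancy π₀ x := by
    refine hη.pos hreach (fun s a => ?_) (E.occupancy_nonneg π₀)
    exact ENNReal.toReal_pos (((π₀ s).mem_support_iff a).1 (by simp [π₀])) ((π₀ s).apply_ne_top a)
  obtain ⟨δ, hδ, hle⟩ : ∃ δ > 0, ∀ x, δ ≤ E.occupancy π₀ x := by
    obtain ⟨s, -⟩ := E.μ₀.support_nonempty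
    have : Nonempty (S × A) := ⟨(s, Classical.arbitrary A)⟩
    obtain ⟨x, hx⟩ := Finite.exists_min (E.occupancy π₀)
    exact ⟨_, hpos x, hx⟩
  refine ⟨π₀, δ, hδ, fun v hv hvδ => ?_⟩
  obtain ⟨π, hπ⟩ := exists_isOccupancy (E := E) (η := fun x => E.occupancy π₀ x + v x)
    (fun x => by
      have := (abs_le.1 ((PiLp.norm_apply_le v x).trans hvδ)).1
      linarith [hle x])
    (fun s => by
      simp only [inflow, add_mul, Finset.sum_add_distrib, hη.sum_eq,
        E.mem_flowDirections_iff.1 hv s]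
      ring)
  refine ⟨π, fun R => ?_⟩
  rw [hπ.J_eq, hη.J_eq, inner_flowReward hv]
  simp only [add_mul, Finset.sum_add_distrib, add_sub_cancel_left]

variable {E} in
/-- The lower bound on the worst-case regret. If `x₁`, `x₂` are the flow components of the
standardised rewards, then the direction `x₁ - t • x₂`, for the point `t • x₂` nearest to `x₁` on
the ray of `x₂`, does not increase the return of the second reward, while it increases that of the
first one at a rate comparable to the distance of the standardised rewards. -/
theorem IsCanonicalisation.exists_regret [Nonempty A] (hreach : ∀ s, E.IsReachable s)
    {c : Reward S A →ₗ[ℝ] Reward S A} (hc : E.IsCanonicalisation c) {n : Reward S A → ℝ}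
    (hn : IsNormOn (LinearMap.range c) n) :
    ∃ L : ℝ, 0 < L ∧ ∀ R₁ R₂ : Reward S A, ∃ π₁ π₂ : Policy S A, E.J R₂ π₁ ≤ E.J R₂ π₂ ∧
      L * n (c R₁) * n (standardise c n R₁ - standardise c n R₂) ≤ E.J R₁ π₁ - E.J R₁ π₂ := by
  obtain ⟨π₀, δ, hδ, hπ₀⟩ := exists_J_sub_J_eq_inner hreach
  obtain ⟨C, hC, hle⟩ := hn.exists_le_mul hc.isNormOn_norm_flowReward
  refine ⟨δ / (2 * C), by positivity, fun R₁ R₂ => ?_⟩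
  by_cases h1 : n (c R₁) = 0
  · exact ⟨π₀, π₀, le_rfl, by simp [h1]⟩
  obtain ⟨t, ht, hb, ha⟩ := exists_inner_sub_smul_nonpos
    (E.flowReward (standardise c n R₁)) (E.flowReward (standardise c n R₂))
  have hdist := (hn.map_standardise_sub_le R₂ h1 ht).trans (mul_le_mul_of_nonneg_left
    (hle _ (Submodule.sub_mem _ (standardise_mem_range c n R₁)
      (Submodule.smul_mem _ t (standardise_mem_range c n R₂)))) zero_le_two)
  rw [map_sub, map_smul] at hdist
  have hw : E.flowReward (standardise c n R₁) - t • E.flowReward (standardise c n R₂) ∈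
      E.flowDirections :=
    Submodule.sub_mem _ (E.flowReward_mem _) (Submodule.smul_mem _ t (E.flowReward_mem _))
  set w := E.flowReward (standardise c n R₁) - t • E.flowReward (standardise c n R₂)
  -- The direction `w` is scaled to the length `δ`; if `w = 0`, then this is the direction `0`.
  obtain ⟨π, hπ⟩ := hπ₀ ((δ * ‖w‖⁻¹) • w) (Submodule.smul_mem _ _ hw) (by
    rw [norm_smul, Real.norm_of_nonneg (by positivity), mul_assoc]
    exact mul_le_of_le_one_right hδ.le inv_mul_le_one)
  have hn1 := hn.nonneg (c R₁) ⟨R₁, rfl⟩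
  have hn2 := hn.nonneg (c R₂) ⟨R₂, rfl⟩
  refine ⟨π, π₀, ?_, ?_⟩
  · rw [← sub_nonpos, hπ, hc.flowReward_eq_smul hn, real_inner_smul_left, real_inner_smul_right]
    exact mul_nonpos_of_nonneg_of_nonpos (by positivity)
      (mul_nonpos_of_nonneg_of_nonpos hn2 hb)
  · have hgain : δ * ‖w‖⁻¹ * (n (c R₁) * ‖w‖ ^ 2) = n (c R₁) * (δ * ‖w‖) := by
      rcases eq_or_ne ‖w‖ 0 with h | h
      · simp [h]
      · field_simp
    rw [hπ, hc.flowReward_eq_smul hn R₁, real_inner_smul_left, real_inner_smul_right, ha, hgain,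
      mul_comm _ (n (c R₁)), mul_assoc]
    refine mul_le_mul_of_nonneg_left ?_ hn1
    rw [div_mul_eq_mul_div, div_le_iff₀ (by positivity), mul_assoc]
    refine mul_le_mul_of_nonneg_left (hdist.trans_eq (by ring)) hδ.le

variable {E} in
/-- A STARC metric is complete: the regret bound for the standardised rewards carries over to the
metric, as an admissible metric is at most a multiple of any norm. -/
theorem IsSTARC.isComplete [Nonempty A] {d : Reward S A → Reward S A → ℝ} (hd : E.IsSTARC d)
    (hreach : ∀ s, E.IsReachable s) : E.IsComplete d := by
  obtain ⟨c, n, m, hc, hn, ⟨hm, p, hp, l, u, hl, hu, hlu⟩, hdm⟩ := hd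
  obtain ⟨L, hL, hregret⟩ := hc.exists_regret hreach hn
  obtain ⟨C, hC, hCle⟩ := (hp.mono (le_top : LinearMap.range c ≤ ⊤)).exists_le_mul hn
  obtain ⟨C', hC', hCle'⟩ := hc.isNormOn_norm_flowReward.exists_le_mul hn
  have hd0 : ∀ R₁ R₂, 0 ≤ d R₁ R₂ := fun R₁ R₂ => hdm R₁ R₂ ▸ hm.nonneg _ ⟨R₁, rfl⟩ _ ⟨R₂, rfl⟩
  have hdn : ∀ R₁ R₂, d R₁ R₂ ≤ u * C * n (standardise c n R₁ - standardise c n R₂) := by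
    intro R₁ R₂
    rw [hdm, mul_assoc]
    refine (hlu _ ⟨R₁, rfl⟩ _ ⟨R₂, rfl⟩).2.trans (mul_le_mul_of_nonneg_left ?_ hu.le)
    exact hCle _ (Submodule.sub_mem _ (standardise_mem_range c n R₁) (standardise_mem_range c n R₂))
  have hregret' : ∀ R₁ R₂, ∃ π₁ π₂ : Policy S A, E.J R₂ π₁ ≤ E.J R₂ π₂ ∧
      L / (u * C) * n (c R₁) * d R₁ R₂ ≤ E.J R₁ π₁ - E.J R₁ π₂ := by
    intro R₁ R₂
    obtain ⟨π₁, π₂, h, hle⟩ := hregret R₁ R₂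
    refine ⟨π₁, π₂, h, le_trans ?_ hle⟩
    have hn1 := hn.nonneg (c R₁) ⟨R₁, rfl⟩
    calc L / (u * C) * n (c R₁) * d R₁ R₂
        ≤ L / (u * C) * n (c R₁) * (u * C * n (standardise c n R₁ - standardise c n R₂)) := by
          gcongr
          exact hdn R₁ R₂
      _ = _ := by field_simp
  -- A reward with `c R₁ ≠ 0` has distance `0` from every reward with the same policy order.
  have hsame : ∀ R₁ R₂, E.SamePolicyOrder R₁ R₂ → n (c R₁) ≠ 0 → d R₁ R₂ = 0 := by
    intro R₁ R₂ h h1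
    obtain ⟨π₁, π₂, hπ, hle⟩ := hregret' R₁ R₂
    have hpos : 0 < L / (u * C) * n (c R₁) :=
      mul_pos (by positivity) (lt_of_le_of_ne (hn.nonneg _ ⟨R₁, rfl⟩) h1.symm)
    have := (h π₁ π₂).2 hπ
    exact le_antisymm (nonpos_of_mul_nonpos_right (by linarith) hpos) (hd0 R₁ R₂)
  have hsymm : ∀ R₁ R₂, d R₁ R₂ = d R₂ R₁ := fun R₁ R₂ => by
    rw [hdm, hdm, hm.symm _ ⟨R₁, rfl⟩ _ ⟨R₂, rfl⟩]
  refine ⟨⟨fun R _ => ?_, fun R₁ _ R₂ _ => hd0 R₁ R₂, fun R₁ _ R₂ _ => hsymm R₁ R₂,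
    fun R₁ _ R₂ _ R₃ _ => ?_⟩, ?_, fun R₁ R₂ h => ?_⟩
  · rw [hdm, hm.self _ ⟨R, rfl⟩]
  · rw [hdm, hdm, hdm]
    exact hm.triangle _ ⟨R₁, rfl⟩ _ ⟨R₂, rfl⟩ _ ⟨R₃, rfl⟩
  · have hγ : 0 < 2 * (1 - E.γ)⁻¹ * C' :=
      mul_pos (mul_pos two_pos (inv_pos.2 (sub_pos.2 E.γ_lt_one))) hC'
    refine ⟨L / (u * C) / (2 * (1 - E.γ)⁻¹ * C'), div_pos (by positivity) hγ, fun R₁ R₂ => ?_⟩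
    obtain ⟨π₁, π₂, h, hle⟩ := hregret' R₁ R₂
    refine ⟨π₁, π₂, h, le_trans (mul_le_mul_of_nonneg_right ?_ (hd0 R₁ R₂)) hle⟩
    rw [div_mul_eq_mul_div, div_le_iff₀ hγ, mul_assoc]
    refine mul_le_mul_of_nonneg_left ?_ (by positivity)
    calc E.rangeJ R₁ ≤ 2 * (1 - E.γ)⁻¹ * ‖E.flowReward R₁‖ := E.rangeJ_le R₁
      _ ≤ 2 * (1 - E.γ)⁻¹ * (C' * n (c R₁)) := by
        rw [← hc.flowReward_apply]
        exact mul_le_mul_of_nonneg_left (hCle' _ ⟨R₁, rfl⟩)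
          (mul_nonneg zero_le_two (inv_nonneg.2 (sub_nonneg.2 E.γ_lt_one.le)))
      _ = n (c R₁) * (2 * (1 - E.γ)⁻¹ * C') := by ring
  · by_cases h1 : n (c R₁) = 0
    · by_cases h2 : n (c R₂) = 0
      · rw [hdm, hn.standardise_eq_zero h1, ← hn.standardise_eq_zero h2, hm.self _ ⟨R₂, rfl⟩]
      · rw [hsymm]
        exact hsame R₂ R₁ (fun π π' => (h π π').symm) h2
    · exact hsame R₁ R₂ h h1

end Evaluation

end Env

end STARC

end

theorem mainTheorem2 {S A : Type*}
    [Fintype S] [MeasurableSpace S] [MeasurableSingletonClass S]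
    [Fintype A] [Nonempty A] [MeasurableSpace A] [MeasurableSingletonClass A]
    (E : STARC.Env S A) (hreach : ∀ s, E.IsReachable s)
    (d : STARC.Reward S A → STARC.Reward S A → ℝ) (hd : E.IsSTARC d) :
    E.IsComplete d :=
  hd.isComplete hreach
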